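/- Let $\mathbb X=\mathbb C^n$, let $P$ be a set of parameters, and let $\mathcal B_{a,b}$ ($a,b\in P$) be maps $\mathbb X^3\to\mathbb X^3$, possibly only partially defined (e.g. rational), of the form $\mathcal B_{a,b}(x,y,z)=(x,\varphi_{a,b}(x,y,z),z)$. (A single map is the case of a one-point $P$; an equation between compositions of partial maps means equality wherever both sides are defined.) For a map $f$ of $\mathbb X^3$ let $f_2$, $f_3$ be the maps of $\mathbb X^4$ that act as $f$ on the factors $1,2,3$, resp. $2,3,4$, and as the identity on the remaining one. Assume the braid-type relation $$(\mathcal B_{a_1,a_2})_3(\mathcal B_{a_1,a_3})_2(\mathcal B_{a_2,a_3})_3=(\mathcal B_{a_2,a_3})_2(\mathcal B_{a_1,a_3})_3(\mathcal B_{a_1,a_2})_2\qquad(a_1,a_2,a_3\in P).$$ Let $G$ be a connected complex Lie group acting holomorphically on $\mathbb X^3$ by transformations $(x,y,z)\mapsto(X(x;g),Y(y;g),Z(z;g))$, where $X,Y,Z$ are actions of $G$ on $\mathbb X$. Assume that every transformation in $G$ commutes with every $\mathcal B_{a,b}$ and that $G$ acts regularly on $\mathbb X^3$ with $n$-dimensional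 orbits: all orbits have complex dimension $n$, and each point has arbitrarily small neighbourhoods that meet every orbit in a path connected (possibly empty) set. Then: 1. The maps $\mathcal B_{a,b}$ project to unique (partial) maps $\bar B_{a,b}$ of the orbit space $\mathbb X^3/G$. 2. The projection satisfies the braid relation in all braid variables. Here braid variables are a bijection $\Phi:\mathbb X^3/G\to\mathbb X^2$ given by functionally independent invariants assigned to edges, $\Phi([x,y,z])=(u,v)=(I(x,y),I(y,z))$ with one holomorphic $I:\mathbb X\times\mathbb X\to\mathbb X$, such that every triple in $\mathbb X^3$ is of the form $(I(x_1,x_2),I(x_2,x_3),I(x_3,x_4))$. For any such $\Phi$, the maps $B_{a,b}=\Phi\,\bar B_{a,b}\,\Phi^{-1}$ of $\mathbb X^2$ satisfy $$B^{(2,3)}_{a_1,a_2}B^{(1,2)}_{a_1,a_3}B^{(2,3)}_{a_2,a_3}=B^{(1,2)}_{a_2,a_3}B^{(2,3)}_{a_1,a_3}B^{(1,2)}_{a_1,a_2}\qquad\text{on }\mathbb X^3,\ \text{for all } a_1,a_2,a_3\in P.$$ 3. Braid variables exist whenever $X=Y=Z$, and more generally whenever the orbits of pairs $(x,y)$ under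 $(X,Y)$ coincide with the orbits of pairs $(y,z)$ under $(Y,Z)$ and each of the actions $X,Y,Z$ on $\mathbb X$ has $n$-dimensional orbits. -/

import Mathlib

open scoped Manifold ContDiff Topology

namespace BraidSymmetry

noncomputable section

/-- The space `𝕏 = ℂⁿ`. -/
abbrev Sp (n : ℕ) : Type := Fin n → ℂ

/-- `𝕏³`. -/
abbrev Sp3 (n : ℕ) : Type := Sp n × Sp n × Sp n

/-- `𝕏⁴`. -/
abbrev Sp4 (n : ℕ) : Type := Sp n × Sp n × Sp n × Sp n

/-! ### Maps of `𝕏³`, the flip form and the braid-type relation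

All maps may be partially defined (for instance rational); an everywhere defined map is the special
case of a partial map with full domain.  They form a family indexed by two parameters from an
arbitrary set `P`; a single map is the case of a one-point set `P`.  An equation between
compositions of partial maps means equality at the points where both sides are defined. -/

section Maps

variable {n : ℕ} {P : Type*}

/-- `𝓑` has the form `(x, y, z) ↦ (x, φ(x, y, z), z)`: it flips the middle vertex of a
quadrilateral and keeps the two outer ones. -/
def IsFlip (𝓑 : P → P → Sp3 n →. Sp3 n) : Prop :=
  ∀ a b : P, ∀ p q : Sp3 n, q ∈ 𝓑 a b p → q.1 = p.1 ∧ q.2.2 = p.2.2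

/-- A map of `𝕏³` acting on the first three factors of `𝕏⁴`. -/
def onFirst (f : Sp3 n →. Sp3 n) : Sp4 n →. Sp4 n := fun q =>
  (f (q.1, q.2.1, q.2.2.1)).map fun r => (r.1, r.2.1, r.2.2, q.2.2.2)

/-- A map of `𝕏³` acting on the last three factors of `𝕏⁴`. -/
def onLast (f : Sp3 n →. Sp3 n) : Sp4 n →. Sp4 n := fun q =>
  (f (q.2.1, q.2.2.1, q.2.2.2)).map fun r => (q.1, r.1, r.2.1, r.2.2)

/-- The braid-type relation `𝓑₃ 𝓑₂ 𝓑₃ = 𝓑₂ 𝓑₃ 𝓑₂` on `𝕏⁴`; the three edges of a chain of four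
vertices carry the parameters `a₁, a₂, a₃`, and a flip interchanges the parameters of the two edges
on which it acts. -/
def BraidType (𝓑 : P → P → Sp3 n →. Sp3 n) : Prop :=
  ∀ a₁ a₂ a₃ : P, ∀ q r s : Sp4 n,
    r ∈ ((onLast (𝓑 a₁ a₂)).comp ((onFirst (𝓑 a₁ a₃)).comp (onLast (𝓑 a₂ a₃)))) q →
    s ∈ ((onFirst (𝓑 a₂ a₃)).comp ((onLast (𝓑 a₁ a₃)).comp (onFirst (𝓑 a₁ a₂)))) q →
    r = s

/-- `B⁽¹²⁾`: a map of `𝕏²` acting on the first two factors of `𝕏³`. -/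
def on12 (f : Sp n × Sp n →. Sp n × Sp n) : Sp3 n →. Sp3 n := fun t =>
  (f (t.1, t.2.1)).map fun r => (r.1, r.2, t.2.2)

/-- `B⁽²³⁾`: a map of `𝕏²` acting on the last two factors of `𝕏³`. -/
def on23 (f : Sp n × Sp n →. Sp n × Sp n) : Sp3 n →. Sp3 n := fun t =>
  (f (t.2.1, t.2.2)).map fun r => (t.1, r.1, r.2)

/-- The (parameter) braid relation `B⁽²³⁾ B⁽¹²⁾ B⁽²³⁾ = B⁽¹²⁾ B⁽²³⁾ B⁽¹²⁾` on `𝕏³`. -/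
def Braid (B : P → P → Sp n × Sp n →. Sp n × Sp n) : Prop :=
  ∀ a₁ a₂ a₃ : P, ∀ t r s : Sp3 n,
    r ∈ ((on23 (B a₁ a₂)).comp ((on12 (B a₁ a₃)).comp (on23 (B a₂ a₃)))) t →
    s ∈ ((on12 (B a₂ a₃)).comp ((on23 (B a₁ a₃)).comp (on12 (B a₁ a₂)))) t →
    r = s

end Maps

/-! ### Groups of transformations of `𝕏³` -/

section Groups

variable {n : ℕ} {E : Type*} [NormedAddCommGroup E] [NormedSpace ℂ E]
  {G : Type*} [Group G] [TopologicalSpace G] [ChartedSpace E G]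

/-- The (complex) rank at the identity of the orbit map `g ↦ g · p` of a group of transformations
of a complex vector space; this is the dimension of the orbit of `p`. -/
def orbitDim (E : Type*) [NormedAddCommGroup E] [NormedSpace ℂ E]
    {G : Type*} [Group G] [TopologicalSpace G] [ChartedSpace E G]
    {V : Type*} [NormedAddCommGroup V] [NormedSpace ℂ V] (act : G → V → V) (p : V) : ℕ :=
  Module.finrank ℂ
    (LinearMap.range (mfderiv 𝓘(ℂ, E) 𝓘(ℂ, V) (fun g : G => act g p) 1).toLinearMap)

variable (n E G) in
/-- A group of transformations `(x, y, z) ↦ (X(x; g), Y(y; g), Z(z; g))` of `𝕏³`: three actions of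
`G` on `𝕏`, each holomorphic in the group element and the point jointly. -/
structure PointGroup where
  X : G →* Equiv.Perm (Sp n)
  Y : G →* Equiv.Perm (Sp n)
  Z : G →* Equiv.Perm (Sp n)
  holX : ContMDiff (𝓘(ℂ, E).prod 𝓘(ℂ, Sp n)) 𝓘(ℂ, Sp n) ω (fun q : G × Sp n => X q.1 q.2)
  holY : ContMDiff (𝓘(ℂ, E).prod 𝓘(ℂ, Sp n)) 𝓘(ℂ, Sp n) ω (fun q : G × Sp n => Y q.1 q.2)
  holZ : ContMDiff (𝓘(ℂ, E).prod 𝓘(ℂ, Sp n)) 𝓘(ℂ, Sp n) ω (fun q : G × Sp n => Z q.1 q.2)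

namespace PointGroup

variable (A : PointGroup n E G)

/-- The transformation of `𝕏³` given by `g`. -/
def act (g : G) (p : Sp3 n) : Sp3 n := (A.X g p.1, A.Y g p.2.1, A.Z g p.2.2)

/-- Lying on the same orbit in `𝕏³`. -/
def orbitSetoid : Setoid (Sp3 n) where
  r p q := ∃ g : G, A.act g p = q
  iseqv :=
    { refl := fun p => ⟨1, by simp [act]⟩
      symm := by
        rintro p q ⟨g, rfl⟩
        exact ⟨g⁻¹, by simp [act]⟩
      trans := by
        rintro p q r ⟨g, rfl⟩ ⟨h, rfl⟩
        exact ⟨h * g, by simp [act]⟩ }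

/-- The set `𝕏³/G` of orbits. -/
abbrev OrbitSpace : Type := Quotient A.orbitSetoid

/-- The orbit of `p`. -/
def orbit (p : Sp3 n) : Set (Sp3 n) := Set.range fun g : G => A.act g p

/-- `G` acts regularly on `𝕏³` with `n`-dimensional orbits: all orbits have dimension `n`, and each
point has arbitrarily small neighbourhoods that meet every orbit in a path connected (possibly
empty) set. -/
def IsRegular : Prop :=
  (∀ p : Sp3 n, orbitDim E A.act p = n) ∧
  ∀ p : Sp3 n, ∀ V ∈ 𝓝 p, ∃ U ⊆ V, IsOpen U ∧ p ∈ U ∧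
    ∀ q : Sp3 n, (A.orbit q ∩ U).Nonempty → IsPathConnected (A.orbit q ∩ U)

/-- `G` is a group of symmetries of the maps `𝓑`: `G ∘ 𝓑 = 𝓑 ∘ G`. -/
def IsSymmetry {P : Type*} (𝓑 : P → P → Sp3 n →. Sp3 n) : Prop :=
  ∀ a b : P, ∀ g : G, ∀ p : Sp3 n, 𝓑 a b (A.act g p) = (𝓑 a b p).map (A.act g)

/-- `Bbar` is the projection of `𝓑` to the set of orbits. -/
def IsProjection {P : Type*} (𝓑 : P → P → Sp3 n →. Sp3 n)
    (Bbar : P → P → A.OrbitSpace →. A.OrbitSpace) : Prop :=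
  ∀ a b : P, ∀ p : Sp3 n,
    Bbar a b (Quotient.mk A.orbitSetoid p) = (𝓑 a b p).map (Quotient.mk A.orbitSetoid)

/-- `Φ : 𝕏³/G ≃ 𝕏²` consists of braid variables `(u, v) = (I(x, y), I(y, z))` assigned to the two
edges `(x, y)`, `(y, z)` of the chain `(x, y, z)`, with one holomorphic function `I`: they are
functionally independent, and the edges of chains of four vertices carry all triples of values.
Completeness of this set of invariants is the injectivity of `Φ`. -/
structure IsBraidVariables (I : Sp n → Sp n → Sp n) (Φ : A.OrbitSpace ≃ Sp n × Sp n) : Prop where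
  holomorphic : ContDiff ℂ ω (fun p : Sp n × Sp n => I p.1 p.2)
  coordinates : ∀ x y z : Sp n, Φ (Quotient.mk A.orbitSetoid (x, y, z)) = (I x y, I y z)
  independent : ∀ p : Sp3 n, Function.Surjective
    (fderiv ℂ (fun p : Sp3 n => (I p.1 p.2.1, I p.2.1 p.2.2)) p)
  onto : ∀ u v w : Sp n, ∃ x₁ x₂ x₃ x₄ : Sp n, I x₁ x₂ = u ∧ I x₂ x₃ = v ∧ I x₃ x₄ = w

/-- The two edges `(x, y)` and `(y, z)` of a chain `(x, y, z)` are alike for `G`: the orbits of the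
pairs `(x, y)` under `(X, Y)` are those of the pairs `(y, z)` under `(Y, Z)`, and the orbits of the
single vertices are `n`-dimensional as well.  If `X = Y = Z`, the first property is trivial, and the
last three follow from the orbits in `𝕏³` being `n`-dimensional, at the points `(x, x, x)`. -/
structure EdgesAlike : Prop where
  edges : ∀ x y x' y' : Sp n,
    (∃ g : G, A.X g x = x' ∧ A.Y g y = y') ↔ (∃ g : G, A.Y g x = x' ∧ A.Z g y = y')
  dimX : ∀ x : Sp n, orbitDim E (fun g : G => A.X g) x = n
  dimY : ∀ y : Sp n, orbitDim E (fun g : G => A.Y g) y = n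
  dimZ : ∀ z : Sp n, orbitDim E (fun g : G => A.Z g) z = n

/-- A partial map of the orbit space, written in the coordinates `Φ`. -/
def inCoordinates {P : Type*} (Φ : A.OrbitSpace ≃ Sp n × Sp n)
    (Bbar : P → P → A.OrbitSpace →. A.OrbitSpace) : P → P → Sp n × Sp n →. Sp n × Sp n :=
  fun a b c => (Bbar a b (Φ.symm c)).map Φ

end PointGroup

end Groups

end

end BraidSymmetry

open BraidSymmetry

namespace BraidSymmetry

/-! Projection: equivariance makes the orbit of an image depend only on the orbit of the point.
Braid relation: lift a triple of edge values to a chain of four vertices. A flip moves only the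
middle vertex of three, so the remaining edge of the chain keeps its value, and each coordinate map
lifts to a flip of the chain. Both sides lift to chains with the same starting point; the braid-type
relation identifies the final chains, hence their edge values (`braid_inCoordinates`).

Existence of braid variables: the infinitesimal stabilizer of a triple is the intersection of those
of its three vertices. All have codimension `n` in the Lie algebra, so they coincide, and since the
vertices vary independently there is one infinitesimal stabilizer for all points and all three
actions. Each action on `𝕏` is transitive, because its orbits are open and `𝕏` is connected. The
stabilizer of a point agrees near the identity with the kernel of the action, so `𝕏` is covered by
the connected group `G ⧸ K`; as `𝕏` is simply connected, the covering is injective and stabilizers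
act trivially (`eq_one_of_fixes_point`).

Consequently, if `γ x` carries `x` to `0` under `X`, its action under `Y` depends on `x` alone, and
`I x y = Y (γ x) y` is a holomorphic complete invariant of pairs (`exists_pair_invariant`).
Alikeness of edges lets the same `I` serve for the pairs `(y, z)`, and the two edge values together
determine the orbit of the triple. -/

/-! ### Coverings of simply connected homogeneous spaces and the local form of submersions -/

/-- A covering argument: if the stabilizer `H` of a point of a simply connected homogeneous space
of a connected group agrees near the identity with a normal subgroup `K ≤ H`, then `H = K`. -/
theorem subgroup_le_of_simplyConnected_quotient {G : Type*} [Group G] [TopologicalSpace G]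
    [IsTopologicalGroup G] [ConnectedSpace G] {B : Type*} [TopologicalSpace B]
    [SimplyConnectedSpace B] [LocallyPathConnectedSpace B] (H K : Subgroup G) [K.Normal]
    (hKH : K ≤ H) {p : G → B} (hp : IsOpenQuotientMap p)
    (hpH : ∀ g g' : G, p g = p g' ↔ g⁻¹ * g' ∈ H)
    {U : Set G} (hU : U ∈ 𝓝 (1 : G)) (hUH : ∀ h ∈ U, h ∈ H → h ∈ K) : H ≤ K := by
  let f : G ⧸ K → B := Quotient.lift p fun a b hab =>
    (hpH a b).2 (hKH (QuotientGroup.leftRel_apply.1 hab))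
  have hfmk : ∀ g : G, f (g : G ⧸ K) = p g := fun g => rfl
  have hfcomp : f ∘ (QuotientGroup.mk : G → G ⧸ K) = p := rfl
  have hf : Topology.IsQuotientMap f := by
    have hc : Continuous f := hp.continuous.quotient_lift _
    refine Topology.IsQuotientMap.of_comp QuotientGroup.continuous_mk hc ?_
    rw [hfcomp]; exact hp.isQuotientMap
  let S : Subgroup (G ⧸ K) := H.map (QuotientGroup.mk' K)
  have hS : ∀ g : G, (g : G ⧸ K) ∈ S ↔ g ∈ H := by
    intro g
    constructor
    · rintro ⟨h, hh, hhg⟩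
      have : h⁻¹ * g ∈ K := QuotientGroup.eq.1 hhg
      simpa using H.mul_mem hh (hKH this)
    · intro hg
      exact ⟨g, hg, rfl⟩
  have hfS : ∀ {a b : G ⧸ K}, f a = f b ↔ a⁻¹ * b ∈ S := by
    intro a b
    induction a using QuotientGroup.induction_on with | H a => ?_
    induction b using QuotientGroup.induction_on with | H b => ?_
    rw [hfmk, hfmk, hpH, ← hS]
    rfl
  -- The image of `U` is a neighbourhood of `1` in `G ⧸ K` that meets `S` only in `1`.
  have hdisc : IsDiscrete (S : Set (G ⧸ K)) := by
    rw [isDiscrete_iff_discreteTopology]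
    change DiscreteTopology S
    rw [discreteTopology_iff_isOpen_singleton_one, isOpen_singleton_iff_nhds_eq_pure]
    refine le_antisymm ?_ (pure_le_nhds _)
    rw [Filter.le_pure_iff, mem_nhds_subtype]
    refine ⟨(QuotientGroup.mk : G → G ⧸ K) '' U,
      (QuotientGroup.isOpenMap_coe).image_mem_nhds hU, ?_⟩
    rintro ⟨_, hs⟩ ⟨u, hu, rfl⟩
    have : u ∈ K := hUH u hu ((hS u).1 hs)
    exact Subtype.ext ((QuotientGroup.eq_one_iff u).2 this)
  have hcov : IsCoveringMap f := (hf.isQuotientCoveringMap_of_subgroupOp S hdisc hfS).isCoveringMap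
  -- Simple connectedness of `B` lifts the identity to a section `s` of `f`. Then `s ∘ f` and `id`
  -- are lifts of `f` that agree at `1`, so they are equal on the connected space `G ⧸ K`, and `f`
  -- is injective.
  obtain ⟨s, ⟨hs1, hs⟩, -⟩ := hcov.existsUnique_continuousMap_lifts
    (ContinuousMap.id B) (f 1) (1 : G ⧸ K) rfl
  have : PreconnectedSpace (G ⧸ K) :=
    inferInstanceAs (PreconnectedSpace (Quotient (QuotientGroup.leftRel K)))
  have hsf : s ∘ f = id := by
    refine hcov.eq_of_comp_eq (s.continuous.comp hf.continuous) continuous_id ?_ 1 hs1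
    rw [← Function.comp_assoc, hs]; rfl
  intro h hh
  have h1 : f (h : G ⧸ K) = f 1 := hfS.2 (S.mul_mem (S.inv_mem ((hS h).2 hh)) S.one_mem)
  have h2 : (h : G ⧸ K) = 1 := (Function.LeftInverse.injective (g := s) (congrFun hsf)) h1
  exact (QuotientGroup.eq_one_iff h).1 h2

/-- A submersion has a local section; and a function whose derivative vanishes on the kernels of the
derivatives of a submersion is constant on the nearby part of a fibre. -/
theorem submersion_section_and_fibre {E F : Type*} [NormedAddCommGroup E] [NormedSpace ℂ E]
    [FiniteDimensional ℂ E] [NormedAddCommGroup F] [NormedSpace ℂ F] [FiniteDimensional ℂ F]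
    {p : E → F} {e₀ : E} (hp : ContDiffAt ℂ ω p e₀)
    (hsurj : Function.Surjective (fderiv ℂ p e₀)) :
    (∃ σ : F → E, ContDiffAt ℂ ω σ (p e₀) ∧ σ (p e₀) = e₀ ∧ ∀ᶠ x in 𝓝 (p e₀), p (σ x) = x) ∧
    ∀ W ∈ 𝓝 e₀, ∃ U ∈ 𝓝 e₀, ∀ q : E → F, (∀ e ∈ W, DifferentiableAt ℂ q e) →
      (∀ e ∈ W, ∀ v, fderiv ℂ p e v = 0 → fderiv ℂ q e v = 0) →
      ∀ e ∈ U, p e = p e₀ → q e = q e₀ := by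
  have : CompleteSpace E := FiniteDimensional.complete ℂ E
  have : CompleteSpace F := FiniteDimensional.complete ℂ F
  set f' := fderiv ℂ p e₀ with hf'
  let N := LinearMap.ker f'.toLinearMap
  obtain ⟨π, hπ⟩ : ∃ π : E →L[ℂ] N, ∀ x : N, π x = x :=
    Submodule.ClosedComplemented.of_finiteDimensional N
  -- Adding a projection to the kernel turns the submersion into a local diffeomorphism in whose
  -- coordinates the fibres are slices `{p e₀} × N`.
  have hbij : Function.Bijective (f'.prod π) := by
    constructor
    · rw [injective_iff_map_eq_zero]
      intro v hv
      obtain ⟨h1, h2⟩ := Prod.ext_iff.1 hv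
      have h3 : π v = ⟨v, h1⟩ := hπ ⟨v, h1⟩
      have h2' : π v = 0 := h2
      rw [h2'] at h3
      exact (congrArg Subtype.val h3).symm
    · rintro ⟨y, k⟩
      obtain ⟨v, rfl⟩ := hsurj y
      refine ⟨v + ((k - π v : N) : E), ?_⟩
      have h1 : f' ((k - π v : N) : E) = 0 := (k - π v).2
      refine Prod.ext ?_ ?_
      · change f' (v + _) = f' v
        rw [map_add, h1, add_zero]
      · change π (v + _) = k
        rw [map_add, hπ, add_sub_cancel]
  let Ψ' : E ≃L[ℂ] F × N := ContinuousLinearEquiv.ofBijective (f'.prod π)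
    (LinearMap.ker_eq_bot.2 hbij.1) (LinearMap.range_eq_top.2 hbij.2)
  let ψ : E → F × N := fun e => (p e, π e)
  have hψ : ContDiffAt ℂ ω ψ e₀ := hp.prodMk π.contDiff.contDiffAt
  have hψ' : HasFDerivAt ψ (Ψ' : E →L[ℂ] F × N) e₀ :=
    (hp.differentiableAt (by simp)).hasFDerivAt.prodMk π.hasFDerivAt
  let Ψ := hψ.toOpenPartialHomeomorph ψ hψ' (by simp)
  have hΨ : ∀ e, Ψ e = (p e, π e) := fun e => rfl
  have he₀ : e₀ ∈ Ψ.source := hψ.mem_toOpenPartialHomeomorph_source hψ' (by simp)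
  have ht₀ : (p e₀, π e₀) ∈ Ψ.target := Ψ.map_source he₀
  have hsymm : ContDiffAt ℂ ω Ψ.symm (p e₀, π e₀) := hψ.to_localInverse hψ' (by simp)
  have hinv₀ : Ψ.symm (p e₀, π e₀) = e₀ := Ψ.left_inv he₀
  have hright : ∀ t ∈ Ψ.target, p (Ψ.symm t) = t.1 := fun t ht =>
    congrArg Prod.fst (Ψ.right_inv ht)
  refine ⟨⟨fun x => Ψ.symm (x, π e₀), ?_, hinv₀, ?_⟩, ?_⟩
  · exact ContDiffAt.comp (p e₀) hsymm (contDiffAt_id.prodMk contDiffAt_const)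
  · have : Filter.Tendsto (fun x : F => (x, π e₀)) (𝓝 (p e₀)) (𝓝 (p e₀, π e₀)) :=
      (Continuous.prodMk continuous_id continuous_const).continuousAt
    filter_upwards [this (Ψ.open_target.mem_nhds ht₀)] with x hx using hright _ hx
  -- `U` depends on `W` but not on `q`; this uniformity later gives one neighbourhood of the
  -- identity that works for all points at once.
  · intro W hW
    have hev : ∀ᶠ t in 𝓝 (p e₀, π e₀), t ∈ Ψ.target ∧ Ψ.symm t ∈ W ∧
        DifferentiableAt ℂ Ψ.symm t ∧ DifferentiableAt ℂ p (Ψ.symm t) := by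
      have hc : Filter.Tendsto Ψ.symm (𝓝 (p e₀, π e₀)) (𝓝 e₀) := by
        have := hsymm.continuousAt.tendsto
        rwa [hinv₀] at this
      have h1 : ∀ᶠ t in 𝓝 (p e₀, π e₀), ContDiffAt ℂ 1 Ψ.symm t :=
        (hsymm.of_le le_top).eventually (by simp)
      have h2 : ∀ᶠ e in 𝓝 e₀, ContDiffAt ℂ 1 p e := (hp.of_le le_top).eventually (by simp)
      filter_upwards [Ψ.open_target.mem_nhds ht₀, hc hW, h1, hc.eventually h2] with t a b c d
      exact ⟨a, b, c.differentiableAt (by simp), d.differentiableAt (by simp)⟩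
    obtain ⟨r, hr, hball⟩ := Metric.eventually_nhds_iff_ball.1 hev
    refine ⟨Ψ.source ∩ Ψ ⁻¹' Metric.ball (p e₀, π e₀) r,
      Ψ.continuousAt he₀ |>.preimage_mem_nhds (Metric.ball_mem_nhds _ hr) |>
        Filter.inter_mem (Ψ.open_source.mem_nhds he₀), ?_⟩
    rintro q hq hker e ⟨hes, heb⟩ hpe
    have hin : ∀ k ∈ Metric.ball (π e₀) r, (p e₀, k) ∈ Metric.ball (p e₀, π e₀) r := by
      intro k hk
      rw [Metric.mem_ball, Prod.dist_eq, dist_self]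
      exact max_lt hr hk
    have hderiv : ∀ k ∈ Metric.ball (π e₀) r,
        HasFDerivAt (fun k => q (Ψ.symm (p e₀, k))) (0 : N →L[ℂ] F) k := by
      intro k hk
      obtain ⟨h1, h2, h3, h4⟩ := hball _ (hin k hk)
      have hj : HasFDerivAt (fun k : N => (p e₀, k)) (ContinuousLinearMap.inr ℂ F N) k :=
        hasFDerivAt_prodMk_right _ _
      have hs := h3.hasFDerivAt.comp k hj
      have hps := h4.hasFDerivAt.comp k hs
      have hqs := (hq _ h2).hasFDerivAt.comp k hs
      have hpc : HasFDerivAt (p ∘ (Ψ.symm ∘ fun k => (p e₀, k))) (0 : N →L[ℂ] F) k := by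
        refine (hasFDerivAt_const (p e₀) k).congr_of_eventuallyEq ?_
        filter_upwards [Metric.isOpen_ball.mem_nhds hk] with k' hk'
        exact hright _ (hball _ (hin k' hk')).1
      -- Since `p` is constant along the slice, the tangent directions of the slice lie in the
      -- kernel of `fderiv ℂ p`, where `fderiv ℂ q` vanishes too.
      have h0 := hps.unique hpc
      have : (fderiv ℂ q (Ψ.symm (p e₀, k))).comp
          ((fderiv ℂ Ψ.symm (p e₀, k)).comp (ContinuousLinearMap.inr ℂ F N)) = 0 := by
        ext1 v
        exact hker _ h2 _ (DFunLike.congr_fun h0 v)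
      exact this ▸ hqs
    have hk : π e ∈ Metric.ball (π e₀) r := by
      have : dist (Ψ e) (p e₀, π e₀) < r := heb
      rw [hΨ, Prod.dist_eq] at this
      exact (le_max_right _ _).trans_lt this
    have hconst := (convex_ball (π e₀) r).is_const_of_fderivWithin_eq_zero (𝕜 := ℂ)
      (f := fun k => q (Ψ.symm (p e₀, k)))
      (fun k hk => (hderiv k hk).differentiableAt.differentiableWithinAt)
      (fun k hk => by
        rw [fderivWithin_of_isOpen Metric.isOpen_ball hk]; exact (hderiv k hk).fderiv)
      hk (Metric.mem_ball_self hr)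
    have hle : Ψ.symm (p e₀, π e) = e := by rw [← hpe]; exact Ψ.left_inv hes
    simpa [hle, hinv₀] using hconst

/-! ### Derivatives of orbit maps of a holomorphic action -/

section HolomorphicActions

variable {E : Type*} [NormedAddCommGroup E] [NormedSpace ℂ E]
  {G : Type*} [Group G] [TopologicalSpace G] [ChartedSpace E G]
  {V : Type*} [NormedAddCommGroup V] [NormedSpace ℂ V]

/-- Joint holomorphy of an action in the group element and the point. -/
def HolAction (E : Type*) [NormedAddCommGroup E] [NormedSpace ℂ E]
    {G : Type*} [Group G] [TopologicalSpace G] [ChartedSpace E G]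
    {V : Type*} [NormedAddCommGroup V] [NormedSpace ℂ V] (ρ : G →* Equiv.Perm V) : Prop :=
  ContMDiff (𝓘(ℂ, E).prod 𝓘(ℂ, V)) 𝓘(ℂ, V) ω (fun q : G × V => ρ q.1 q.2)

/-- The derivative at the identity of an orbit map. -/
noncomputable def orbitDeriv (E : Type*) [NormedAddCommGroup E] [NormedSpace ℂ E]
    {G : Type*} [Group G] [TopologicalSpace G] [ChartedSpace E G]
    {V : Type*} [NormedAddCommGroup V] [NormedSpace ℂ V] (act : G → V → V) (p : V) : E →L[ℂ] V :=
  mfderiv 𝓘(ℂ, E) 𝓘(ℂ, V) (fun g : G => act g p) 1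

theorem HolAction.orbitMap {ρ : G →* Equiv.Perm V} (hρ : HolAction E ρ) (x : V) :
    ContMDiff 𝓘(ℂ, E) 𝓘(ℂ, V) ω (fun g : G => ρ g x) :=
  hρ.comp (contMDiff_id.prodMk contMDiff_const)

theorem HolAction.transformation {ρ : G →* Equiv.Perm V} (hρ : HolAction E ρ) (g : G) :
    ContDiff ℂ ω (fun x => ρ g x) :=
  (hρ.comp (contMDiff_const.prodMk contMDiff_id)).contDiff

variable [LieGroup 𝓘(ℂ, E) ω G]

/-- The orbit map of `x` in the chart of the group at the identity. -/
noncomputable def chartOrbit (E : Type*) [NormedAddCommGroup E] [NormedSpace ℂ E]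
    {G : Type*} [Group G] [TopologicalSpace G] [ChartedSpace E G]
    {V : Type*} [NormedAddCommGroup V] [NormedSpace ℂ V] (ρ : G →* Equiv.Perm V) (x : V) (e : E) :
    V := ρ ((extChartAt 𝓘(ℂ, E) (1 : G)).symm e) x

theorem chartOrbit_contDiffAt {ρ : G →* Equiv.Perm V} (hρ : HolAction E ρ) (x : V) {e : E}
    (he : e ∈ (extChartAt 𝓘(ℂ, E) (1 : G)).target) : ContDiffAt ℂ ω (chartOrbit E ρ x) e := by
  rw [← contMDiffAt_iff_contDiffAt]
  have : IsManifold 𝓘(ℂ, E) ω G := LieGroup.toContMDiffMul.toIsManifold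
  have h := (contMDiffOn_extChartAt_symm (I := 𝓘(ℂ, E)) (n := ω) (1 : G)).contMDiffAt
    ((isOpen_extChartAt_target (I := 𝓘(ℂ, E)) (1 : G)).mem_nhds he)
  exact (hρ.orbitMap x).contMDiffAt.comp e h

/-- The derivative of an orbit map at any group element factors through its derivative at the
identity, by a map that depends on the group only. -/
theorem exists_fderiv_chartOrbit_eq {e : E} (he : e ∈ (extChartAt 𝓘(ℂ, E) (1 : G)).target) :
    ∃ L : E →L[ℂ] E, ∀ ρ : G →* Equiv.Perm V, HolAction E ρ → ∀ x : V,
      fderiv ℂ (chartOrbit E ρ x) e = (orbitDeriv E (fun g => ρ g)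
        (ρ ((extChartAt 𝓘(ℂ, E) (1 : G)).symm e) x)).comp L := by
  have : IsManifold 𝓘(ℂ, E) ω G := LieGroup.toContMDiffMul.toIsManifold
  set c := extChartAt 𝓘(ℂ, E) (1 : G) with hc
  -- Right translation brings the base point to the identity; the orbit map of `x` is then the orbit
  -- map of the moved point composed with `m`, and `m` involves no action.
  let m : E → G := fun e' => c.symm e' * (c.symm e)⁻¹
  have hm : ContMDiffAt 𝓘(ℂ, E) 𝓘(ℂ, E) ω m e :=
    ((contMDiffOn_extChartAt_symm (I := 𝓘(ℂ, E)) (n := ω) (1 : G)).contMDiffAt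
    ((isOpen_extChartAt_target (I := 𝓘(ℂ, E)) (1 : G)).mem_nhds he)).mul contMDiffAt_const
  have hm1 : m e = 1 := mul_inv_cancel _
  refine ⟨mfderiv 𝓘(ℂ, E) 𝓘(ℂ, E) m e, fun ρ hρ x => ?_⟩
  have hcomp : chartOrbit E ρ x = (fun g : G => ρ g (ρ (c.symm e) x)) ∘ m := by
    funext e'
    simp [chartOrbit, m, hc]
  have h := mfderiv_comp (I'' := 𝓘(ℂ, V)) e
    (((hρ.orbitMap (ρ (c.symm e) x)) (m e)).mdifferentiableAt (by simp))
    (hm.mdifferentiableAt (by simp))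
  rw [← hcomp, mfderiv_eq_fderiv, hm1] at h
  exact h

/-- This carries surjectivity of the orbit derivative at the identity over to the chart, where the
submersion lemma applies. -/
theorem orbitDeriv_eq_fderiv_chartOrbit_comp {ρ : G →* Equiv.Perm V} (hρ : HolAction E ρ) (x : V) :
    ∃ L : E →L[ℂ] E, orbitDeriv E (fun g => ρ g) x =
      (fderiv ℂ (chartOrbit E ρ x) (extChartAt 𝓘(ℂ, E) (1 : G) 1)).comp L := by
  have : IsManifold 𝓘(ℂ, E) ω G := LieGroup.toContMDiffMul.toIsManifold
  set c := extChartAt 𝓘(ℂ, E) (1 : G) with hc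
  have hcd : MDifferentiableAt 𝓘(ℂ, E) 𝓘(ℂ, E) c 1 :=
    (contMDiffAt_extChartAt (n := ω)).mdifferentiableAt (by simp)
  refine ⟨mfderiv 𝓘(ℂ, E) 𝓘(ℂ, E) c 1, ?_⟩
  have hcd2 := (contMDiffAt_iff_contDiffAt.2
    (chartOrbit_contDiffAt hρ x (mem_extChartAt_target (1 : G)))).mdifferentiableAt (by simp)
  have h := mfderiv_comp (1 : G) hcd2 hcd
  rw [mfderiv_eq_fderiv] at h
  refine Eq.trans ?_ h
  refine Filter.EventuallyEq.mfderiv_eq ?_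
  filter_upwards [extChartAt_source_mem_nhds (I := 𝓘(ℂ, E)) (1 : G)] with g hg
  simp only [Function.comp, chartOrbit]
  rw [(extChartAt 𝓘(ℂ, E) (1 : G)).left_inv hg]

end HolomorphicActions

/-! ### Transitivity, stabilizers and the pair invariant -/

section TransitiveActions

variable {E : Type*} [NormedAddCommGroup E] [NormedSpace ℂ E] [FiniteDimensional ℂ E]
  {G : Type*} [Group G] [TopologicalSpace G] [ChartedSpace E G] [LieGroup 𝓘(ℂ, E) ω G]
  {V : Type*} [NormedAddCommGroup V] [NormedSpace ℂ V] [FiniteDimensional ℂ V]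
  {ρ τ : G →* Equiv.Perm V}

omit [FiniteDimensional ℂ E] [FiniteDimensional ℂ V] in
theorem chartOrbit_fderiv_surjective (hρ : HolAction E ρ) {x : V}
    (hx : Function.Surjective (orbitDeriv E (fun g => ρ g) x)) :
    Function.Surjective (fderiv ℂ (chartOrbit E ρ x) (extChartAt 𝓘(ℂ, E) (1 : G) 1)) := by
  obtain ⟨L, hL⟩ := orbitDeriv_eq_fderiv_chartOrbit_comp hρ x
  rw [hL] at hx
  exact Function.Surjective.of_comp hx

theorem exists_local_section (hρ : HolAction E ρ) {x₀ : V}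
    (hx : Function.Surjective (orbitDeriv E (fun g => ρ g) x₀)) :
    ∃ s : V → G, ContMDiffAt 𝓘(ℂ, V) 𝓘(ℂ, E) ω s x₀ ∧ s x₀ = 1 ∧ ∀ᶠ x in 𝓝 x₀, ρ (s x) x₀ = x := by
  have : IsManifold 𝓘(ℂ, E) ω G := LieGroup.toContMDiffMul.toIsManifold
  have he := mem_extChartAt_target (I := 𝓘(ℂ, E)) (1 : G)
  obtain ⟨⟨σ, hσ, hσ0, hσp⟩, -⟩ := submersion_section_and_fibre
    (chartOrbit_contDiffAt hρ x₀ he) (chartOrbit_fderiv_surjective hρ hx)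
  have h1 : chartOrbit E ρ x₀ (extChartAt 𝓘(ℂ, E) (1 : G) 1) = x₀ := by
    simp [chartOrbit]
  rw [h1] at hσ hσ0 hσp
  refine ⟨fun x => (extChartAt 𝓘(ℂ, E) (1 : G)).symm (σ x), ?_, ?_, hσp⟩
  · have h := (contMDiffOn_extChartAt_symm (I := 𝓘(ℂ, E)) (n := ω) (1 : G)).contMDiffAt
      ((isOpen_extChartAt_target (I := 𝓘(ℂ, E)) (1 : G)).mem_nhds he)
    rw [← hσ0] at h
    exact h.comp x₀ hσ.contMDiffAt
  · simp [hσ0]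

/-- Local sections make the orbit maps open. The complement of an orbit is a union of open orbits,
so an orbit is clopen and fills the connected space `V`. -/
theorem isOpenQuotientMap_orbitMap (hρ : HolAction E ρ)
    (hsurj : ∀ x, Function.Surjective (orbitDeriv E (fun g => ρ g) x)) (x₀ : V) :
    IsOpenQuotientMap (fun g : G => ρ g x₀) := by
  have : IsTopologicalGroup G := topologicalGroup_of_lieGroup 𝓘(ℂ, E) ω
  have hopen : ∀ x₀, IsOpenMap (fun g : G => ρ g x₀) := by
    intro x₀
    refine IsOpenMap.of_nhds_le fun g₀ S hS => ?_
    obtain ⟨s, hs, hs1, hsx⟩ := exists_local_section hρ (hsurj (ρ g₀ x₀))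
    have hc : Filter.Tendsto (fun x => s x * g₀) (𝓝 (ρ g₀ x₀)) (𝓝 g₀) := by
      have := hs.continuousAt.tendsto.mul_const g₀
      rwa [hs1, one_mul] at this
    filter_upwards [hc hS, hsx] with x h1 h2
    have h3 : ρ (s x * g₀) x₀ ∈ S := h1
    rwa [map_mul, Equiv.Perm.mul_apply, h2] at h3
  refine ⟨?_, (hρ.orbitMap x₀).continuous, hopen x₀⟩
  have hclopen : IsClopen (Set.range fun g : G => ρ g x₀) := by
    refine ⟨⟨?_⟩, (hopen x₀).isOpen_range⟩
    have : (Set.range fun g : G => ρ g x₀)ᶜ =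
        ⋃ y ∈ (Set.range fun g : G => ρ g x₀)ᶜ, Set.range fun g : G => ρ g y := by
      ext y
      simp only [Set.mem_iUnion, exists_prop]
      constructor
      · exact fun hy => ⟨y, hy, 1, by simp⟩
      · rintro ⟨y', hy', g, rfl⟩ ⟨h, hh⟩
        refine hy' ⟨g⁻¹ * h, ?_⟩
        have hh' : ρ h x₀ = ρ g y' := hh
        simp [hh']
    rw [this]
    exact isOpen_biUnion fun y _ => (hopen y).isOpen_range
  exact Set.range_eq_univ.1 (hclopen.eq_univ ⟨_, 1, rfl⟩)

/-- Near the identity, the orbit maps of `τ` are constant along the fibre of the orbit map of `x₀`.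
Kernels must be compared at all pairs of points, because the derivative at a group element is the
derivative at the identity taken at the moved points. -/
theorem locally_trivial_of_ker_le (hρ : HolAction E ρ) (hτ : HolAction E τ)
    (hker : ∀ x y v, orbitDeriv E (fun g => ρ g) x v = 0 → orbitDeriv E (fun g => τ g) y v = 0)
    {x₀ : V} (hx : Function.Surjective (orbitDeriv E (fun g => ρ g) x₀)) :
    ∃ U ∈ 𝓝 (1 : G), ∀ h ∈ U, ρ h x₀ = x₀ → τ h = 1 := by
  set c := extChartAt 𝓘(ℂ, E) (1 : G) with hc
  have he : c 1 ∈ c.target := mem_extChartAt_target (1 : G)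
  have hW : c.target ∈ 𝓝 (c 1) := (isOpen_extChartAt_target (1 : G)).mem_nhds he
  obtain ⟨U, hU, hUq⟩ := (submersion_section_and_fibre
    (chartOrbit_contDiffAt hρ x₀ he) (chartOrbit_fderiv_surjective hρ hx)).2 c.target hW
  refine ⟨c.source ∩ c ⁻¹' U, Filter.inter_mem (extChartAt_source_mem_nhds (1 : G))
    ((continuousAt_extChartAt (1 : G)).preimage_mem_nhds hU), ?_⟩
  rintro h ⟨hs, hhU⟩ hfix
  ext1 y
  have key := hUq (chartOrbit E τ y)
    (fun e he' => (chartOrbit_contDiffAt hτ y he').differentiableAt (by simp)) (fun e he' v hv => by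
      obtain ⟨L, hL⟩ := exists_fderiv_chartOrbit_eq (V := V) he'
      rw [hL ρ hρ] at hv
      rw [hL τ hτ]
      exact hker _ _ _ hv) (c h) hhU
  simp only [chartOrbit, ← hc] at key
  rw [c.left_inv hs, c.left_inv (mem_extChartAt_source (1 : G))] at key
  simpa using key (by simpa using hfix)

/-- An element of a connected group that fixes one point of a transitive action on a vector space
acts trivially, if the infinitesimal stabilizers of all points coincide; it then acts trivially in
any other action with the same infinitesimal stabilizers. -/
theorem eq_one_of_fixes_point [ConnectedSpace G] (hρ : HolAction E ρ) (hτ : HolAction E τ)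
    (hsurj : ∀ x, Function.Surjective (orbitDeriv E (fun g => ρ g) x))
    (hkerρ : ∀ x y v, orbitDeriv E (fun g => ρ g) x v = 0 → orbitDeriv E (fun g => ρ g) y v = 0)
    (hkerτ : ∀ x y v, orbitDeriv E (fun g => ρ g) x v = 0 → orbitDeriv E (fun g => τ g) y v = 0)
    {h : G} {x₀ : V} (hfix : ρ h x₀ = x₀) : τ h = 1 := by
  have : IsTopologicalGroup G := topologicalGroup_of_lieGroup 𝓘(ℂ, E) ω
  -- The real structure provides contractibility and local path connectedness of `V`.
  have : NormedSpace ℝ V := NormedSpace.restrictScalars ℝ ℂ V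
  obtain ⟨U₁, hU₁, h₁⟩ := locally_trivial_of_ker_le hρ hρ hkerρ (hsurj x₀)
  obtain ⟨U₂, hU₂, h₂⟩ := locally_trivial_of_ker_le hρ hτ hkerτ (hsurj x₀)
  let H : Subgroup G :=
    { carrier := {g | ρ g x₀ = x₀}
      mul_mem' := fun {a b} ha hb => by
        have ha' : ρ a x₀ = x₀ := ha
        have hb' : ρ b x₀ = x₀ := hb
        simp [ha', hb']
      one_mem' := by simp
      inv_mem' := fun {a} ha => by
        have ha' : ρ a x₀ = x₀ := ha
        simp [Equiv.symm_apply_eq, ha'] }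
  -- Intersecting both kernels keeps `K` inside the stabilizer `H` and lets a single covering
  -- argument yield triviality under `τ`.
  let K : Subgroup G := ρ.ker ⊓ τ.ker
  have hKH : K ≤ H := fun k hk => by
    have : ρ k = 1 := hk.1
    change ρ k x₀ = x₀
    simp [this]
  have key := subgroup_le_of_simplyConnected_quotient H K hKH
    (isOpenQuotientMap_orbitMap hρ hsurj x₀) (fun g g' => by
      change ρ g x₀ = ρ g' x₀ ↔ ρ (g⁻¹ * g') x₀ = x₀
      rw [map_mul, map_inv, Equiv.Perm.mul_apply, Equiv.Perm.inv_eq_iff_eq, eq_comm])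
    (Filter.inter_mem hU₁ hU₂) (fun h hh hH => ⟨h₁ h hh.1 hH, h₂ h hh.2 hH⟩)
  exact (key (show h ∈ H from hfix)).2

/-- In a group whose action `ρ` is transitive, with stabilizers that act trivially under `τ`, the
holomorphic pair invariant that carries `x` to the origin and records the position of `y`. -/
theorem exists_pair_invariant [ConnectedSpace G] (hρ : HolAction E ρ) (hτ : HolAction E τ)
    (hsurj : ∀ x, Function.Surjective (orbitDeriv E (fun g => ρ g) x))
    (hfix : ∀ h x, ρ h x = x → τ h = 1) :
    ∃ I : V → V → V, ContDiff ℂ ω (fun p : V × V => I p.1 p.2) ∧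
      (∀ x y x' y', I x y = I x' y' ↔ ∃ g : G, ρ g x = x' ∧ τ g y = y') ∧
      (∀ x v, ∃ y, I x y = v) ∧
      ∀ x y, Function.Surjective (fderiv ℂ (I x) y) := by
  have htrans : ∀ x, ∃ g : G, ρ g x = 0 := fun x =>
    (isOpenQuotientMap_orbitMap hρ hsurj x).surjective 0
  -- The choice need not be continuous: `τ (γ x)` does not depend on it.
  choose γ hγ using htrans
  have hτeq : ∀ a b x, ρ a x = ρ b x → τ a = τ b := by
    intro a b x hab
    have : τ (b⁻¹ * a) = 1 := hfix _ x (by simp [hab])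
    rw [map_mul, map_inv, inv_mul_eq_one] at this
    exact this.symm
  refine ⟨fun x y => τ (γ x) y, ?_, ?_, ?_, ?_⟩
  · rw [contDiff_iff_contDiffAt]
    rintro ⟨x₁, y₁⟩
    obtain ⟨s, hs, hs1, hsx⟩ := exists_local_section hρ (hsurj x₁)
    -- Near `x₁` the element `γ x₁ * (s x)⁻¹` also carries `x` to `0`, and it varies holomorphically
    -- with `x`.
    have hsm : ContMDiffAt 𝓘(ℂ, V × V) 𝓘(ℂ, V) ω
        (fun p : V × V => τ (γ x₁ * (s p.1)⁻¹) p.2) (x₁, y₁) := by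
      have hfst : ContMDiffAt 𝓘(ℂ, V × V) 𝓘(ℂ, V) ω (Prod.fst : V × V → V) (x₁, y₁) :=
        contDiff_fst.contMDiff.contMDiffAt
      have hsnd : ContMDiffAt 𝓘(ℂ, V × V) 𝓘(ℂ, V) ω (Prod.snd : V × V → V) (x₁, y₁) :=
        contDiff_snd.contMDiff.contMDiffAt
      have hs' : ContMDiffAt 𝓘(ℂ, V × V) 𝓘(ℂ, E) ω (fun p : V × V => s p.1) (x₁, y₁) :=
        ContMDiffAt.comp (x₁, y₁) hs hfst
      exact (hτ _).comp (x₁, y₁) ((contMDiffAt_const.mul hs'.inv).prodMk hsnd)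
    refine hsm.contDiffAt.congr_of_eventuallyEq ?_
    filter_upwards [continuousAt_fst.eventually hsx] with p hp
    have hp' : ρ (s p.1) x₁ = p.1 := hp
    have : τ (γ p.1) = τ (γ x₁ * (s p.1)⁻¹) := by
      refine hτeq _ _ p.1 ?_
      have hinv : ρ (s p.1)⁻¹ p.1 = x₁ := by
        rw [map_inv, Equiv.Perm.inv_eq_iff_eq, hp']
      rw [hγ, map_mul, Equiv.Perm.mul_apply, hinv, hγ]
    simp only [this]
  · intro x y x' y'
    constructor
    · intro h
      refine ⟨(γ x')⁻¹ * γ x, ?_, ?_⟩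
      · simp [hγ, Equiv.symm_apply_eq]
      · have h' : τ (γ x) y = τ (γ x') y' := h
        simp [h']
    · rintro ⟨g, rfl, rfl⟩
      have : τ (γ x) = τ (γ (ρ g x) * g) := hτeq _ _ x (by simp [hγ])
      simp [this]
  · exact fun x v => ⟨τ (γ x)⁻¹ v, by simp⟩
  · intro x y
    have hd : ∀ g y, HasFDerivAt (fun y => τ g y) (fderiv ℂ (fun y => τ g y) y) y := fun g y =>
      ((hτ.transformation g).differentiable (by simp) y).hasFDerivAt
    have h2 := (hd (γ x)⁻¹ (τ (γ x) y))
    have h1 : HasFDerivAt (fun y => τ (γ x) y) (fderiv ℂ (fun y => τ (γ x) y) y)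
        (τ (γ x)⁻¹ (τ (γ x) y)) := by
      simpa using hd (γ x) y
    have h3 := h1.comp _ h2
    have h4 : ((fun y => τ (γ x) y) ∘ fun y => τ (γ x)⁻¹ y) = id := by
      funext z; simp
    rw [h4] at h3
    have h5 := h3.unique (hasFDerivAt_id _)
    intro v
    exact ⟨_, DFunLike.congr_fun h5 v⟩

end TransitiveActions

/-! ### Comparison of infinitesimal stabilizers and construction of braid variables -/

section OrbitDimension

variable {n : ℕ} {E : Type*} [NormedAddCommGroup E] [NormedSpace ℂ E] [FiniteDimensional ℂ E]
  {G : Type*} [Group G] [TopologicalSpace G] [ChartedSpace E G]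

omit [FiniteDimensional ℂ E] in
theorem orbitDeriv_surjective_of_orbitDim {act : G → Sp n → Sp n} {x : Sp n}
    (h : orbitDim E act x = n) : Function.Surjective (orbitDeriv E act x) := by
  refine LinearMap.range_eq_top.1 (Submodule.eq_top_of_finrank_eq
    (S := LinearMap.range (orbitDeriv E act x).toLinearMap) ?_)
  rw [Module.finrank_fin_fun]
  exact h

theorem finrank_ker_orbitDeriv {V : Type*} [NormedAddCommGroup V] [NormedSpace ℂ V]
    (act : G → V → V) (p : V) :
    orbitDim E act p + Module.finrank ℂ (LinearMap.ker (orbitDeriv E act p).toLinearMap) =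
      Module.finrank ℂ E :=
  LinearMap.finrank_range_add_finrank_ker (orbitDeriv E act p).toLinearMap

variable [LieGroup 𝓘(ℂ, E) ω G]

namespace PointGroup

variable (A : PointGroup n E G)

omit [FiniteDimensional ℂ E] [LieGroup 𝓘(ℂ, E) ω G] in
theorem orbitDeriv_act (p : Sp3 n) (v : E) :
    orbitDeriv E A.act p v = (orbitDeriv E (fun g => A.X g) p.1 v,
      orbitDeriv E (fun g => A.Y g) p.2.1 v, orbitDeriv E (fun g => A.Z g) p.2.2 v) := by
  have h : ∀ {ρ : G →* Equiv.Perm (Sp n)} (_ : HolAction E ρ) (x : Sp n),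
      HasMFDerivAt 𝓘(ℂ, E) 𝓘(ℂ, Sp n) (fun g : G => ρ g x) 1 (orbitDeriv E (fun g => ρ g) x) :=
    fun hρ x => ((hρ.orbitMap x 1).mdifferentiableAt (by simp)).hasMFDerivAt
  have hp : ∀ {W₁ W₂ : Type} [NormedAddCommGroup W₁] [NormedSpace ℂ W₁] [NormedAddCommGroup W₂]
      [NormedSpace ℂ W₂] {f₁ : G → W₁} {f₂ : G → W₂} {d₁ : E →L[ℂ] W₁} {d₂ : E →L[ℂ] W₂},
      HasMFDerivAt 𝓘(ℂ, E) 𝓘(ℂ, W₁) f₁ 1 d₁ → HasMFDerivAt 𝓘(ℂ, E) 𝓘(ℂ, W₂) f₂ 1 d₂ →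
      HasMFDerivAt 𝓘(ℂ, E) 𝓘(ℂ, W₁ × W₂) (fun g => (f₁ g, f₂ g)) 1 (d₁.prod d₂) :=
    fun h₁ h₂ => ⟨h₁.1.prodMk h₂.1, h₁.2.prodMk h₂.2⟩
  have h3 := hp (h A.holX p.1) (hp (h A.holY p.2.1) (h A.holZ p.2.2))
  have h4 : orbitDeriv E A.act p = _ := h3.mfderiv
  rw [h4]
  rfl

-- By rank and nullity both kernels have codimension `n`, so the inclusion `hle` is an equality.
omit [LieGroup 𝓘(ℂ, E) ω G] in
theorem ker_orbitDeriv_le {act : G → Sp n → Sp n} {x : Sp n} {p : Sp3 n}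
    (hp : orbitDim E A.act p = n) (hx : orbitDim E act x = n)
    (hle : ∀ v, orbitDeriv E A.act p v = 0 → orbitDeriv E act x v = 0) (v : E)
    (hv : orbitDeriv E act x v = 0) : orbitDeriv E A.act p v = 0 := by
  have h1 := finrank_ker_orbitDeriv (E := E) A.act p
  have h2 := finrank_ker_orbitDeriv (E := E) act x
  have heq := Submodule.eq_of_le_of_finrank_eq
    (S₁ := LinearMap.ker (orbitDeriv E A.act p).toLinearMap)
    (S₂ := LinearMap.ker (orbitDeriv E act x).toLinearMap) hle (by omega)
  have : v ∈ LinearMap.ker (orbitDeriv E act x).toLinearMap := hv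
  rw [← heq] at this
  exact this

omit [LieGroup 𝓘(ℂ, E) ω G] in
theorem edgesAlike_of_eq (hreg : ∀ p : Sp3 n, orbitDim E A.act p = n) (hXY : A.X = A.Y)
    (hYZ : A.Y = A.Z) : A.EdgesAlike := by
  have hdim : ∀ x : Sp n, orbitDim E (fun g : G => A.Z g) x = n := by
    intro x
    have h1 := finrank_ker_orbitDeriv (E := E) A.act (x, x, x)
    have h2 := finrank_ker_orbitDeriv (E := E) (fun g : G => A.Z g) x
    have heq : LinearMap.ker (orbitDeriv E A.act (x, x, x)).toLinearMap =
        LinearMap.ker (orbitDeriv E (fun g : G => A.Z g) x).toLinearMap := by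
      ext v
      simp [LinearMap.mem_ker, A.orbitDeriv_act, hXY, hYZ]
    rw [heq, hreg] at h1
    omega
  exact ⟨fun x y x' y' => by rw [hXY, hYZ], by simpa only [hXY, hYZ] using hdim,
    by simpa only [hYZ] using hdim, hdim⟩

theorem exists_braidVariables [ConnectedSpace G]
    (hreg : ∀ p : Sp3 n, orbitDim E A.act p = n) (hA : A.EdgesAlike) :
    ∃ I Φ, A.IsBraidVariables I Φ := by
  have hX : HolAction E A.X := A.holX
  have hY : HolAction E A.Y := A.holY
  have hZ : HolAction E A.Z := A.holZ
  have kerX : ∀ p : Sp3 n, ∀ v, orbitDeriv E (fun g => A.X g) p.1 v = 0 →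
      orbitDeriv E A.act p v = 0 := fun p =>
    A.ker_orbitDeriv_le (hreg p) (hA.dimX p.1) fun v hv => by
      rw [A.orbitDeriv_act] at hv
      exact congrArg Prod.fst hv
  have kerY : ∀ p : Sp3 n, ∀ v, orbitDeriv E (fun g => A.Y g) p.2.1 v = 0 →
      orbitDeriv E A.act p v = 0 := fun p =>
    A.ker_orbitDeriv_le (hreg p) (hA.dimY p.2.1) fun v hv => by
      rw [A.orbitDeriv_act] at hv
      exact congrArg (fun q => q.2.1) hv
  have toX : ∀ p : Sp3 n, ∀ v, orbitDeriv E A.act p v = 0 →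
      orbitDeriv E (fun g => A.X g) p.1 v = 0 := fun p v hv => by
    rw [A.orbitDeriv_act] at hv
    exact congrArg Prod.fst hv
  have toY : ∀ p : Sp3 n, ∀ v, orbitDeriv E A.act p v = 0 →
      orbitDeriv E (fun g => A.Y g) p.2.1 v = 0 := fun p v hv => by
    rw [A.orbitDeriv_act] at hv
    exact congrArg (fun q => q.2.1) hv
  have toZ : ∀ p : Sp3 n, ∀ v, orbitDeriv E A.act p v = 0 →
      orbitDeriv E (fun g => A.Z g) p.2.2 v = 0 := fun p v hv => by
    rw [A.orbitDeriv_act] at hv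
    exact congrArg (fun q => q.2.2) hv
  -- A kernel at one vertex passes through the kernel at the triple to any other vertex; the unused
  -- third vertex is filled with `0`.
  have hXY : ∀ x y v, orbitDeriv E (fun g => A.X g) x v = 0 →
      orbitDeriv E (fun g => A.Y g) y v = 0 := fun x y v h => toY (x, y, 0) v (kerX (x, y, 0) v h)
  have hYX : ∀ y x v, orbitDeriv E (fun g => A.Y g) y v = 0 →
      orbitDeriv E (fun g => A.X g) x v = 0 := fun y x v h => toX (x, y, 0) v (kerY (x, y, 0) v h)
  have hYZ : ∀ y z v, orbitDeriv E (fun g => A.Y g) y v = 0 →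
      orbitDeriv E (fun g => A.Z g) z v = 0 := fun y z v h => toZ (0, y, z) v (kerY (0, y, z) v h)
  have hsX : ∀ x, Function.Surjective (orbitDeriv E (fun g => A.X g) x) := fun x =>
    orbitDeriv_surjective_of_orbitDim (hA.dimX x)
  have hsY : ∀ x, Function.Surjective (orbitDeriv E (fun g => A.Y g) x) := fun x =>
    orbitDeriv_surjective_of_orbitDim (hA.dimY x)
  have fixXY : ∀ h x, A.X h x = x → A.Y h = 1 := fun h x =>
    eq_one_of_fixes_point hX hY hsX (fun x y v hv => hYX 0 y v (hXY x 0 v hv)) hXY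
  have fixYZ : ∀ h x, A.Y h x = x → A.Z h = 1 := fun h x =>
    eq_one_of_fixes_point hY hZ hsY (fun x y v hv => hXY 0 y v (hYX x 0 v hv)) hYZ
  obtain ⟨I, hol, hI, hsol, hder⟩ := exists_pair_invariant hX hY hsX fixXY
  let F : Sp3 n → Sp n × Sp n := fun p => (I p.1 p.2.1, I p.2.1 p.2.2)
  have hFinv : ∀ p q : Sp3 n, F p = F q ↔ ∃ g : G, A.act g p = q := by
    rintro ⟨x, y, z⟩ ⟨x', y', z'⟩
    constructor
    · intro h
      obtain ⟨g, hgx, hgy⟩ := (hI x y x' y').1 (congrArg Prod.fst h)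
      obtain ⟨k, hky, hkz⟩ := (hA.edges y z y' z').1 ((hI y z y' z').1 (congrArg Prod.snd h))
      refine ⟨g, ?_⟩
      -- The edges are matched by possibly different `g` and `k`. Both carry `y` to `y'` under `Y`,
      -- so `g⁻¹ * k` fixes `y` and hence acts trivially under `Z`.
      have hZgk : A.Z (g⁻¹ * k) = 1 := fixYZ _ y (by
        rw [map_mul, Equiv.Perm.mul_apply, hky, map_inv, Equiv.Perm.inv_eq_iff_eq, hgy])
      rw [map_mul, map_inv, inv_mul_eq_one] at hZgk
      simp [act, hgx, hgy, hZgk, hkz]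
    · rintro ⟨g, hg⟩
      have h1 : A.X g x = x' := congrArg Prod.fst hg
      have h2 : A.Y g y = y' := congrArg (fun q => q.2.1) hg
      have h3 : A.Z g z = z' := congrArg (fun q => q.2.2) hg
      exact Prod.ext ((hI x y x' y').2 ⟨g, h1, h2⟩)
        ((hI y z y' z').2 ((hA.edges y z y' z').2 ⟨g, h2, h3⟩))
  let Φ₀ : A.OrbitSpace → Sp n × Sp n := Quotient.lift F fun p q h => (hFinv p q).2 h
  have hΦ : Function.Bijective Φ₀ := by
    constructor
    · intro a b
      induction a using Quotient.inductionOn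
      induction b using Quotient.inductionOn
      exact fun h => Quotient.sound ((hFinv _ _).1 h)
    · rintro ⟨u, v⟩
      obtain ⟨y, hy⟩ := hsol 0 u
      obtain ⟨z, hz⟩ := hsol y v
      exact ⟨Quotient.mk _ (0, y, z), Prod.ext hy hz⟩
  refine ⟨I, Equiv.ofBijective Φ₀ hΦ, hol, fun x y z => rfl, ?_, ?_⟩
  · rintro ⟨x, y, z⟩ ⟨u, v⟩
    have hd : ∀ q : Sp n × Sp n, HasFDerivAt (fun q : Sp n × Sp n => I q.1 q.2)
        (fderiv ℂ (fun q : Sp n × Sp n => I q.1 q.2) q) q := fun q =>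
      (hol.differentiable (by simp) q).hasFDerivAt
    have hpart : ∀ x y, ∀ w, ∃ v,
        fderiv ℂ (fun q : Sp n × Sp n => I q.1 q.2) (x, y) (0, v) = w := by
      intro x y w
      obtain ⟨v, hv⟩ := hder x y w
      have h := ((hd (x, y)).comp y (hasFDerivAt_prodMk_right x y)).fderiv
      have h' : fderiv ℂ (I x) y = _ := h
      rw [h'] at hv
      exact ⟨v, by simpa using hv⟩
    have h12 : HasFDerivAt (fun p : Sp3 n => I p.1 p.2.1) _ (x, y, z) :=
      (hd (x, y)).comp (x, y, z) (f := fun p : Sp3 n => (p.1, p.2.1))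
        (hasFDerivAt_fst.prodMk (hasFDerivAt_fst.comp _ hasFDerivAt_snd))
    have h23 : HasFDerivAt (fun p : Sp3 n => I p.2.1 p.2.2) _ (x, y, z) :=
      (hd (y, z)).comp (x, y, z) (f := fun p : Sp3 n => p.2) hasFDerivAt_snd
    rw [(h12.prodMk h23).fderiv]
    -- The system is triangular: `b` alone attains `u` on the first edge, and `c` corrects for the
    -- effect of `b` on the second.
    obtain ⟨b, hb⟩ := hpart x y u
    obtain ⟨c, hc⟩ := hpart y z
      (v - fderiv ℂ (fun q : Sp n × Sp n => I q.1 q.2) (y, z) (b, 0))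
    refine ⟨(0, b, c), Prod.ext ?_ ?_⟩
    · simpa using hb
    · have hbc : ((b, c) : Sp n × Sp n) = (b, 0) + (0, c) := by simp
      change fderiv ℂ (fun q : Sp n × Sp n => I q.1 q.2) (y, z) (b, c) = v
      rw [hbc, map_add, hc, add_sub_cancel]
  · intro u v w
    obtain ⟨x₂, h₂⟩ := hsol 0 u
    obtain ⟨x₃, h₃⟩ := hsol x₂ v
    obtain ⟨x₄, h₄⟩ := hsol x₃ w
    exact ⟨0, x₂, x₃, x₄, h₂, h₃, h₄⟩

end PointGroup

end OrbitDimension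

/-! ### Projection to the orbit space and the braid relation -/

section Projection

theorem mem_comp_comp {α β γ δ : Type*} {f : α →. β} {g : β →. γ} {h : γ →. δ} {a : α} {d : δ} :
    d ∈ (h.comp (g.comp f)) a ↔ ∃ b c, b ∈ f a ∧ c ∈ g b ∧ d ∈ h c := by
  constructor
  · intro hd
    obtain ⟨c, hc, hd⟩ := Part.mem_bind_iff.1 hd
    obtain ⟨b, hb, hc⟩ := Part.mem_bind_iff.1 hc
    exact ⟨b, c, hb, hc, hd⟩
  · rintro ⟨b, c, hb, hc, hd⟩
    exact Part.mem_bind_iff.2 ⟨c, Part.mem_bind_iff.2 ⟨b, hb, hc⟩, hd⟩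

variable {n : ℕ} {P : Type*} {E : Type*} [NormedAddCommGroup E] [NormedSpace ℂ E]
  {G : Type*} [Group G] [TopologicalSpace G] [ChartedSpace E G] {A : PointGroup n E G}
  {𝓑 : P → P → Sp3 n →. Sp3 n}

theorem exists_isProjection (hsymm : A.IsSymmetry 𝓑) :
    ∃ Bbar : P → P → A.OrbitSpace →. A.OrbitSpace, A.IsProjection 𝓑 Bbar := by
  refine ⟨fun a b => Quotient.lift (fun p => (𝓑 a b p).map (Quotient.mk A.orbitSetoid)) ?_,
    fun a b p => rfl⟩
  rintro p _ ⟨g, rfl⟩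
  simp only [hsymm a b g p, Part.map_map]
  congr 1
  funext q
  exact Quotient.sound ⟨g, rfl⟩

theorem isProjection_unique {Bbar Bbar' : P → P → A.OrbitSpace →. A.OrbitSpace}
    (h : A.IsProjection 𝓑 Bbar) (h' : A.IsProjection 𝓑 Bbar') : Bbar' = Bbar := by
  funext a b c
  induction c using Quotient.inductionOn with | h p => ?_
  exact (h' a b p).trans (h a b p).symm

variable {Bbar : P → P → A.OrbitSpace →. A.OrbitSpace} {I : Sp n → Sp n → Sp n}
  {Φ : A.OrbitSpace ≃ Sp n × Sp n}

/-- The edge variables of a chain of four vertices. -/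
def edgeVariables (I : Sp n → Sp n → Sp n) (q : Sp4 n) : Sp3 n :=
  (I q.1 q.2.1, I q.2.1 q.2.2.1, I q.2.2.1 q.2.2.2)

theorem mem_inCoordinates (hB : A.IsProjection 𝓑 Bbar) (hΦ : A.IsBraidVariables I Φ) {a b : P}
    {x y z : Sp n} {r : Sp n × Sp n} (hr : r ∈ A.inCoordinates Φ Bbar a b (I x y, I y z)) :
    ∃ s ∈ 𝓑 a b (x, y, z), r = (I s.1 s.2.1, I s.2.1 s.2.2) := by
  rw [PointGroup.inCoordinates, ← hΦ.coordinates x y z, Equiv.symm_apply_apply, hB a b,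
    Part.map_map] at hr
  obtain ⟨s, hs, rfl⟩ := (Part.mem_map_iff _).1 hr
  exact ⟨s, hs, hΦ.coordinates _ _ _⟩

/-- The flip keeps the third vertex, so the last edge value of the chain is unchanged. The lift is
moreover defined wherever the coordinate map is, which the partial equations require. -/
theorem mem_on12 (hflip : IsFlip 𝓑) (hB : A.IsProjection 𝓑 Bbar) (hΦ : A.IsBraidVariables I Φ)
    {a b : P} {q : Sp4 n} {r : Sp3 n}
    (hr : r ∈ on12 (A.inCoordinates Φ Bbar a b) (edgeVariables I q)) :
    ∃ q' ∈ onFirst (𝓑 a b) q, edgeVariables I q' = r := by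
  obtain ⟨c, hc, rfl⟩ := (Part.mem_map_iff _).1 hr
  obtain ⟨s, hs, rfl⟩ := mem_inCoordinates hB hΦ hc
  refine ⟨_, Part.mem_map _ hs, ?_⟩
  have h2 : s.2.2 = q.2.2.1 := (hflip a b _ s hs).2
  simp [edgeVariables, h2]

theorem mem_on23 (hflip : IsFlip 𝓑) (hB : A.IsProjection 𝓑 Bbar) (hΦ : A.IsBraidVariables I Φ)
    {a b : P} {q : Sp4 n} {r : Sp3 n}
    (hr : r ∈ on23 (A.inCoordinates Φ Bbar a b) (edgeVariables I q)) :
    ∃ q' ∈ onLast (𝓑 a b) q, edgeVariables I q' = r := by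
  obtain ⟨c, hc, rfl⟩ := (Part.mem_map_iff _).1 hr
  obtain ⟨s, hs, rfl⟩ := mem_inCoordinates hB hΦ hc
  refine ⟨_, Part.mem_map _ hs, ?_⟩
  have h1 : s.1 = q.2.1 := (hflip a b _ s hs).1
  simp [edgeVariables, h1]

theorem braid_inCoordinates (hflip : IsFlip 𝓑) (hbraid : BraidType 𝓑)
    (hB : A.IsProjection 𝓑 Bbar) (hΦ : A.IsBraidVariables I Φ) :
    Braid (A.inCoordinates Φ Bbar) := by
  rintro a₁ a₂ a₃ ⟨u, v, w⟩ r s hr hs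
  -- Both sides are lifted from this one chain, so the braid-type relation applies to the resulting
  -- chains `q₃` and `t₃`.
  obtain ⟨x₁, x₂, x₃, x₄, rfl, rfl, rfl⟩ := hΦ.onto u v w
  change r ∈ PFun.comp _ (PFun.comp _ _) (edgeVariables I (x₁, x₂, x₃, x₄)) at hr
  change s ∈ PFun.comp _ (PFun.comp _ _) (edgeVariables I (x₁, x₂, x₃, x₄)) at hs
  rw [mem_comp_comp] at hr hs
  obtain ⟨_, _, hr₁, hr₂, hr₃⟩ := hr
  obtain ⟨q₁, hq₁, rfl⟩ := mem_on23 hflip hB hΦ hr₁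
  obtain ⟨q₂, hq₂, rfl⟩ := mem_on12 hflip hB hΦ hr₂
  obtain ⟨q₃, hq₃, rfl⟩ := mem_on23 hflip hB hΦ hr₃
  obtain ⟨_, _, hs₁, hs₂, hs₃⟩ := hs
  obtain ⟨t₁, ht₁, rfl⟩ := mem_on12 hflip hB hΦ hs₁
  obtain ⟨t₂, ht₂, rfl⟩ := mem_on23 hflip hB hΦ hs₂
  obtain ⟨t₃, ht₃, rfl⟩ := mem_on12 hflip hB hΦ hs₃
  rw [hbraid a₁ a₂ a₃ (x₁, x₂, x₃, x₄) q₃ t₃ (mem_comp_comp.2 ⟨q₁, q₂, hq₁, hq₂, hq₃⟩)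
    (mem_comp_comp.2 ⟨t₁, t₂, ht₁, ht₂, ht₃⟩)]

end Projection

end BraidSymmetry

theorem mainTheorem4 (n : ℕ) {P : Type*}
    {E : Type*} [NormedAddCommGroup E] [NormedSpace ℂ E] [FiniteDimensional ℂ E]
    {G : Type*} [Group G] [TopologicalSpace G] [ChartedSpace E G] [LieGroup 𝓘(ℂ, E) ω G]
    [T2Space G] [SecondCountableTopology G] [ConnectedSpace G]
    (𝓑 : P → P → Sp3 n →. Sp3 n) (hflip : IsFlip 𝓑) (hbraid : BraidType 𝓑)
    (A : PointGroup n E G) (hreg : A.IsRegular) (hsymm : A.IsSymmetry 𝓑) :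
    ∃ Bbar : P → P → A.OrbitSpace →. A.OrbitSpace,
      A.IsProjection 𝓑 Bbar ∧
      (∀ Bbar', A.IsProjection 𝓑 Bbar' → Bbar' = Bbar) ∧
      (∀ I Φ, A.IsBraidVariables I Φ → Braid (A.inCoordinates Φ Bbar)) ∧
      ((A.X = A.Y ∧ A.Y = A.Z) ∨ A.EdgesAlike → ∃ I Φ, A.IsBraidVariables I Φ) := by
  obtain ⟨Bbar, hB⟩ := exists_isProjection hsymm
  refine ⟨Bbar, hB, fun _ h => isProjection_unique hB h,
    fun _ _ hΦ => braid_inCoordinates hflip hbraid hB hΦ, ?_⟩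
  rintro (⟨hXY, hYZ⟩ | hA)
  · exact A.exists_braidVariables hreg.1 (A.edgesAlike_of_eq hreg.1 hXY hYZ)
  · exact A.exists_braidVariables hreg.1 hA
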